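/- **Setting.** Let $P$ be a Borel probability distribution of $(X,Y)$ on $\mathbb{R}^d\times\{0,1\}$ with regression function $\eta:\mathbb{R}^d\to[0,1]$, i.e. $\eta$ is Borel and $\eta(X)=E[Y\mid X]$ almost surely. Let $\phi(t)=\log(1+e^{-t})$, let $L_\phi(g)=E[\phi((2Y-1)g(X))]\in[0,\infty]$, let $\mathcal{E}_\phi(g)=L_\phi(g)-\inf_{h}L_\phi(h)$, the infimum being over all measurable $h:\mathbb{R}^d\to\mathbb{R}$, and let $f_\phi^*=\log\frac{\eta}{1-\eta}$. A ReLU network with hidden widths $(p_1,\dots,p_L)$ is a composition of $L$ fully connected layers $x\mapsto\max(Wx+b,0)$ followed by an affine map to $\mathbb{R}$; its number of parameters is the number of all its weights and additive constants. For a bounded set $U\subset\mathbb{R}^d$ with non-empty interior and $B>0$, a measurable $f:U\to\mathbb{R}$ belongs to $\mathcal{BA}_B(U)$ if for every integer $m\ge1$ there is a ReLU network $g$ with one hidden layer of $m$ neurons such that $\sup_{U}|f-g|\le\sqrt d\,B\,m^{-1/2}$ and all coefficients of $g$ are bounded in absolute value by $\sqrt B\,\bigl(5+\inf_{x_0\in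 U}[\|x_0\|_1+\vartheta(U,x_0)]\bigr)$, where $\vartheta(U,x_0)=\sup_{\xi\ne0}\|\xi\|_\infty/\sup_{x\in U}|\langle\xi,x-x_0\rangle|$. **Assumptions on $P$** (with constants $c,B>0$). (i) There are $C_0>0$, $\alpha\ge0$ with $P_X(0<|\eta-\frac12|\le t)\le C_0t^\alpha$ for all $t>0$. (ii) $c\le\eta(X)\le1-c$ almost surely. (iii) $X$ lies almost surely in a compact set $\Omega\subset\mathbb{R}^d$. (iv) There are finitely many bounded, non-empty open sets $U_1,\dots,U_M$ covering $\Omega$ with $\eta|_{U_i}\in\mathcal{BA}_B(U_i)$ for every $i$. Let $G=G(\Omega,(U_i))$ be the least number of open axis-parallel boxes, each contained in some $U_i$, that cover $\Omega$; it is finite by compactness. **Theorem.** There is a function $K:\mathbb{N}\to\mathbb{R}$, and for all $c,B>0$ there is a constant $C=C(c,B)>0$, such that for every integer $d>1$ and every $P$ on $\mathbb{R}^d\times\{0,1\}$ that satisfies (i)–(iv) with the constants $c,B$: $f_\phi^*$ minimizes the $\phi$-risk, that is $L_\phi(f_\phi^*)=\inf_hL_\phi(h)$, and for every integer $N\ge1$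 there is a ReLU network $I_N$ with 3 (non-empty) hidden layers and at most $K(G)\,(N+d)$ parameters, hence $O(N)$ parameters for each fixed such $P$, such that $$\mathcal{E}_\phi(I_N)=L_\phi(I_N)-L_\phi(f_\phi^*)\le C\,d\,N^{-1/2}.$$ In particular the constant in front of $N^{-1/2}$ depends linearly on $d$, and $C$ and $K$ do not depend on $d$. -/

import Mathlib

open MeasureTheory Set
open scoped ENNReal Matrix

noncomputable section

/-- A feed-forward ReLU network with `n` real inputs and one real output. The list records the
widths of the hidden layers, starting next to the input. -/
inductive ReLUNet : ℕ → List ℕ → Type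
  | output {n : ℕ} (w : Fin n → ℝ) (b : ℝ) : ReLUNet n []
  | hidden {n k : ℕ} {ps : List ℕ} (W : Matrix (Fin k) (Fin n) ℝ) (b : Fin k → ℝ)
      (rest : ReLUNet k ps) : ReLUNet n (k :: ps)

namespace ReLUNet

/-- The function realized by a network: every hidden layer is `x ↦ max (W x + b) 0`, the output
is affine. -/
def realize : {n : ℕ} → {ps : List ℕ} → ReLUNet n ps → (Fin n → ℝ) → ℝ
  | _, _, output w b, x => w ⬝ᵥ x + b
  | _, _, hidden W b rest, x => rest.realize (fun i => max ((W *ᵥ x) i + b i) 0)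

/-- All coefficients of the network (the additive constants included) are at most `R` in absolute
value. -/
def WeightsBounded (R : ℝ) : {n : ℕ} → {ps : List ℕ} → ReLUNet n ps → Prop
  | _, _, output w b => (∀ j, |w j| ≤ R) ∧ |b| ≤ R
  | _, _, hidden W b rest =>
      (∀ i j, |W i j| ≤ R) ∧ (∀ i, |b i| ≤ R) ∧ rest.WeightsBounded R

/-- The total number of parameters of a fully connected network with `n` inputs and hidden widths
`ps`: all weights and all additive constants, zero or not. -/
def paramCount : ℕ → List ℕ → ℕ
  | n, [] => n + 1
  | n, k :: ps => k * (n + 1) + paramCount k ps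

end ReLUNet

/-- `|ξ|_{U, x₀} = sup_{x ∈ U} |⟨ξ, x - x₀⟩|`. -/
def widthSeminorm {d : ℕ} (U : Set (Fin d → ℝ)) (x₀ ξ : Fin d → ℝ) : ℝ :=
  sSup ((fun x => |ξ ⬝ᵥ (x - x₀)|) '' U)

/-- `ϑ(U, x₀) = sup_{ξ ≠ 0} ‖ξ‖_∞ / |ξ|_{U, x₀}`; the norm of `Fin d → ℝ` is the maximum norm. -/
def vartheta {d : ℕ} (U : Set (Fin d → ℝ)) (x₀ : Fin d → ℝ) : ℝ :=
  sSup ((fun ξ : Fin d → ℝ => ‖ξ‖ / widthSeminorm U x₀ ξ) '' {ξ | ξ ≠ 0})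

/-- `√C * (5 + inf_{x₀ ∈ U} (‖x₀‖₁ + ϑ(U, x₀)))`. -/
def barronWeightBound {d : ℕ} (C : ℝ) (U : Set (Fin d → ℝ)) : ℝ :=
  Real.sqrt C * (5 + sInf ((fun x₀ : Fin d → ℝ => ∑ j, |x₀ j| + vartheta U x₀) '' U))

/-- The restriction of `f` to `U` belongs to the class `BA_C(U)`, for a bounded set `U` with
non-empty interior and `C > 0`. -/
structure InBarronApprox {d : ℕ} (C : ℝ) (U : Set (Fin d → ℝ)) (f : (Fin d → ℝ) → ℝ) : Prop where
  bounded : Bornology.IsBounded U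
  interior_nonempty : (interior U).Nonempty
  pos : 0 < C
  measurable : Measurable (U.domRestrict f)
  approx : ∀ m : ℕ, 1 ≤ m → ∃ g : ReLUNet d [m],
    (∀ x ∈ U, |f x - g.realize x| ≤ Real.sqrt d * C * (m : ℝ) ^ (-(1 / 2) : ℝ)) ∧
    g.WeightsBounded (barronWeightBound C U)

/-- The logistic loss. -/
def logisticLoss (t : ℝ) : ℝ := Real.log (1 + Real.exp (-t))

/-- The label of a sample as a real number, `0` or `1`. -/
def label (y : Fin 2) : ℝ := (y.val : ℝ)

/-- The `φ`-risk `E[φ((2Y - 1) g(X))]`, with value `∞` allowed (the loss is non-negative). -/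
def phiRisk {d : ℕ} (P : Measure ((Fin d → ℝ) × Fin 2)) (g : (Fin d → ℝ) → ℝ) : ℝ≥0∞ :=
  ∫⁻ z, ENNReal.ofReal (logisticLoss ((2 * label z.2 - 1) * g z.1)) ∂P

/-- The infimum of the `φ`-risk over all measurable functions; it is at most `log 2` when `P` is a
probability measure. -/
def optimalPhiRisk {d : ℕ} (P : Measure ((Fin d → ℝ) × Fin 2)) : ℝ≥0∞ :=
  ⨅ h : {h : (Fin d → ℝ) → ℝ // Measurable h}, phiRisk P h.1

/-- The excess `φ`-risk. -/
def excessPhiRisk {d : ℕ} (P : Measure ((Fin d → ℝ) × Fin 2)) (g : (Fin d → ℝ) → ℝ) : ℝ≥0∞ :=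
  phiRisk P g - optimalPhiRisk P

/-- `η` is (a version of) the regression function: a Borel function with values in `[0, 1]` such
that `η(X)` is the conditional expectation of `Y` given `X`. -/
structure IsRegressionFunction {d : ℕ} (P : Measure ((Fin d → ℝ) × Fin 2))
    (η : (Fin d → ℝ) → ℝ) : Prop where
  measurable : Measurable η
  mem_Icc : ∀ x, η x ∈ Icc (0 : ℝ) 1
  condExp_eq : (fun z => η z.1) =ᵐ[P]
    P[fun z => label z.2 | MeasurableSpace.comap Prod.fst inferInstance]

/-- `f_φ^* = log (η / (1 - η))`. -/
def logOdds {d : ℕ} (η : (Fin d → ℝ) → ℝ) (x : Fin d → ℝ) : ℝ := Real.log (η x / (1 - η x))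

/-- The marginal distribution of `X`. -/
def marginalX {d : ℕ} (P : Measure ((Fin d → ℝ) × Fin 2)) : Measure (Fin d → ℝ) :=
  P.map Prod.fst

/-- The margin condition holds for some exponent `α ≥ 0` and some constant. -/
def MarginCondition {d : ℕ} (P : Measure ((Fin d → ℝ) × Fin 2)) (η : (Fin d → ℝ) → ℝ) : Prop :=
  ∃ C₀ α : ℝ, 0 < C₀ ∧ 0 ≤ α ∧ ∀ t : ℝ, 0 < t →
    marginalX P {x | 0 < |η x - 1 / 2| ∧ |η x - 1 / 2| ≤ t} ≤ ENNReal.ofReal (C₀ * t ^ α)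

/-- The assumptions on the distribution `P` of `(X, Y)`, with the data that they mention made
explicit: the regression function `η`, the distance `c` of `η` from `0` and `1`, the compact set
`Ω` that carries `X`, the finite open cover `U`, and a common Barron constant `B`. -/
structure DistributionAssumption {d M : ℕ} (P : Measure ((Fin d → ℝ) × Fin 2))
    (η : (Fin d → ℝ) → ℝ) (c B : ℝ) (Ω : Set (Fin d → ℝ)) (U : Fin M → Set (Fin d → ℝ)) :
    Prop where
  regression : IsRegressionFunction P η
  margin : MarginCondition P η
  bounded_away : ∀ᵐ x ∂(marginalX P), c ≤ η x ∧ η x ≤ 1 - c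
  compact : IsCompact Ω
  supported : marginalX P Ωᶜ = 0
  isOpen : ∀ i, IsOpen (U i)
  cover : Ω ⊆ ⋃ i, U i
  barron : ∀ i, InBarronApprox B (U i) η

/-- The open box `∏ⱼ (a j, b j)`. -/
def openBox {d : ℕ} (a b : Fin d → ℝ) : Set (Fin d → ℝ) := Set.univ.pi fun j => Ioo (a j) (b j)

/-- `Ω` is covered by `n` open boxes, each of them inside one of the sets `U i`. -/
def HasBoxCover {d M : ℕ} (Ω : Set (Fin d → ℝ)) (U : Fin M → Set (Fin d → ℝ)) (n : ℕ) : Prop :=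
  ∃ a b : Fin n → Fin d → ℝ,
    (Ω ⊆ ⋃ k, openBox (a k) (b k)) ∧ ∀ k, ∃ i, openBox (a k) (b k) ⊆ U i

/-- The least number of open boxes, each inside one of the sets `U i`, that cover `Ω`. -/
def boxNumber {d M : ℕ} (Ω : Set (Fin d → ℝ)) (U : Fin M → Set (Fin d → ℝ)) : ℕ :=
  sInf {n | HasBoxCover Ω U n}

/-- A compact set with a finite open cover has a finite box cover, so `boxNumber` is attained. -/
theorem hasBoxCover_boxNumber {d M : ℕ} {Ω : Set (Fin d → ℝ)} {U : Fin M → Set (Fin d → ℝ)}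
    (hΩ : IsCompact Ω) (hU : ∀ i, IsOpen (U i)) (hc : Ω ⊆ ⋃ i, U i) :
    HasBoxCover Ω U (boxNumber Ω U) := by
  suffices h : ∃ n, HasBoxCover Ω U n from Nat.sInf_mem (s := {n | HasBoxCover Ω U n}) h
  have key : ∀ x ∈ Ω, ∃ r : ℝ, 0 < r ∧ ∃ i, Metric.ball x r ⊆ U i := by
    intro x hx
    obtain ⟨i, hi⟩ := mem_iUnion.1 (hc hx)
    obtain ⟨r, hr, hs⟩ := Metric.isOpen_iff.1 (hU i) x hi
    exact ⟨r, hr, i, hs⟩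
  choose! r hr hs using key
  obtain ⟨t, ht, hcov⟩ := hΩ.elim_nhds_subcover (fun x => Metric.ball x (r x))
    (fun x hx => Metric.ball_mem_nhds x (hr x hx))
  have hbox : ∀ x ∈ Ω,
      openBox (fun j => x j - r x) (fun j => x j + r x) = Metric.ball x (r x) := by
    intro x hx
    simp only [openBox, ball_pi x (hr x hx), Real.ball_eq_Ioo]
  refine ⟨t.card, fun k j => (t.equivFin.symm k).1 j - r (t.equivFin.symm k).1,
    fun k j => (t.equivFin.symm k).1 j + r (t.equivFin.symm k).1, ?_, ?_⟩
  · intro y hy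
    obtain ⟨x, hx, hyx⟩ := mem_iUnion₂.1 (hcov hy)
    refine mem_iUnion.2 ⟨t.equivFin ⟨x, hx⟩, ?_⟩
    simp only [Equiv.symm_apply_apply]
    rw [hbox x (ht x hx)]
    exact hyx
  · intro k
    obtain ⟨i, hi⟩ := hs _ (ht _ (t.equivFin.symm k).2)
    exact ⟨i, by rw [hbox _ (ht _ (t.equivFin.symm k).2)]; exact hi⟩

end

/-! The conditional logistic risk is convex in the prediction and stationary at the log-odds, so it
exceeds its minimum by at most the square of the prediction error (`condRisk_le`). A uniform error
of order `√(d/m)` therefore costs only `d/m` in risk, which is `d N^{-1/2}` for `m = ⌊√N⌋`.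

Such an error is reached as follows. On each box of the cover, a shallow network with `m` neurons
approximates `η`. The log-odds is Lipschitz away from `0` and `1`, so `m` ramps approximate it with
error of order `1/m` (`exists_ramp_interpolation`), and composing them with the local network
approximates `f_φ^*`. The local compositions are glued by a priority rule: the first box containing
the point wins, and the third layer suppresses all others (`exists_gluedNet`). This works except on
thin shells inside the box boundaries. There the output is still bounded, and the shells can be
given arbitrarily small probability (`exists_measure_shell_le`).

Consecutive layers of width `O(Gm)` need `O(G²m²)` parameters, provided `d ≤ m`. If `m < d`, the
claimed bound is at least `1` and the zero network suffices. -/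

/-! ### Networks as explicit formulas -/

theorem ReLUNet.measurable_realize : ∀ {n : ℕ} {ps : List ℕ} (I : ReLUNet n ps),
    Measurable I.realize
  | _, _, .output w b => by
      change Measurable fun x => w ⬝ᵥ x + b
      unfold dotProduct
      fun_prop
  | _, _, .hidden W b rest => by
      have h := rest.measurable_realize
      have h2 : Measurable (fun x : Fin _ → ℝ => fun i => max ((W *ᵥ x) i + b i) 0) := by
        unfold Matrix.mulVec dotProduct
        fun_prop
      exact h.comp h2

/-- Networks with one hidden layer are explicit sums of ridge functions. -/
theorem ReLUNet.exists_realize_eq_sum {d m : ℕ} (g : ReLUNet d [m]) :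
    ∃ (W : Fin m → Fin d → ℝ) (b w : Fin m → ℝ) (b' : ℝ), ∀ x,
      g.realize x = ∑ i, w i * max (∑ j, W i j * x j + b i) 0 + b' := by
  cases g with
  | hidden W b rest =>
    cases rest with
    | output w b' => exact ⟨W, b, w, b', fun x => rfl⟩

/-- Three-layer networks whose neurons are indexed by arbitrary finite types. -/
theorem ReLUNet.exists_threeLayer {d : ℕ} {ι₁ ι₂ ι₃ : Type*} [Fintype ι₁] [Fintype ι₂]
    [Fintype ι₃] (W₁ : ι₁ → Fin d → ℝ) (b₁ : ι₁ → ℝ) (W₂ : ι₂ → ι₁ → ℝ) (b₂ : ι₂ → ℝ)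
    (W₃ : ι₃ → ι₂ → ℝ) (b₃ : ι₃ → ℝ) (w : ι₃ → ℝ) (b : ℝ) :
    ∃ I : ReLUNet d [Fintype.card ι₁, Fintype.card ι₂, Fintype.card ι₃], ∀ x, I.realize x =
      ∑ c, w c * max (∑ i, W₃ c i * max (∑ a, W₂ i a * max (∑ j, W₁ a j * x j + b₁ a) 0
        + b₂ i) 0 + b₃ c) 0 + b := by
  let e₁ := (Fintype.equivFin ι₁).symm
  let e₂ := (Fintype.equivFin ι₂).symm
  let e₃ := (Fintype.equivFin ι₃).symm
  refine ⟨.hidden (fun i j => W₁ (e₁ i) j) (fun i => b₁ (e₁ i))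
    (.hidden (fun i j => W₂ (e₂ i) (e₁ j)) (fun i => b₂ (e₂ i))
    (.hidden (fun i j => W₃ (e₃ i) (e₂ j)) (fun i => b₃ (e₃ i))
    (.output (fun i => w (e₃ i)) b))), fun x => ?_⟩
  simp only [ReLUNet.realize, Matrix.mulVec, dotProduct]
  congr 1
  refine Fintype.sum_equiv e₃ _ _ fun c => ?_
  congr 3
  refine Fintype.sum_equiv e₂ _ _ fun i => ?_
  congr 3
  exact Fintype.sum_equiv e₁ _ _ fun a => rfl

theorem ReLUNet.exists_const_zero (d : ℕ) :
    ∃ I : ReLUNet d [1, 1, 1], ∀ x, I.realize x = 0 := by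
  refine ⟨.hidden 0 0 (.hidden 0 0 (.hidden 0 0 (.output 0 0))), fun x => ?_⟩
  simp [ReLUNet.realize]

/-! ### Interpolation by ramps -/

/-- A Lipschitz function on an interval is approximated by a linear combination of clipped ramps
on `p` equal subintervals. -/
theorem exists_ramp_interpolation {a b L : ℝ} (hab : a < b) (hL : 0 ≤ L) {h : ℝ → ℝ}
    (hh : ∀ s ∈ Icc a b, ∀ t ∈ Icc a b, |h s - h t| ≤ L * |s - t|) {p : ℕ} (hp : 1 ≤ p) :
    ∃ (κ τ : Fin p × Bool → ℝ) (A₀ A : ℝ), 0 ≤ A ∧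
      (∀ t, |∑ i, κ i * max (t - τ i) 0 + A₀| ≤ A) ∧
      ∀ t, ∀ s ∈ Icc a b, |∑ i, κ i * max (t - τ i) 0 + A₀ - h s| ≤
        L * |t - s| + 2 * L * ((b - a) / p) := by
  have hp0 : (0 : ℝ) < p := by exact_mod_cast hp
  obtain ⟨δ, hδ⟩ : ∃ δ, δ = (b - a) / p := ⟨_, rfl⟩
  have hδ0 : 0 < δ := hδ ▸ div_pos (by linarith) hp0
  have hpδ : p * δ = b - a := by rw [hδ]; field_simp
  let q : ℕ → ℝ := fun i => a + i * δ
  have hq0 : q 0 = a := by simp [q]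
  have hqp : q p = b := by simp only [q]; linarith
  have hqs : ∀ i, q (i + 1) = q i + δ := fun i => by simp only [q]; push_cast; ring
  have hqmono : Monotone q := monotone_nat_of_le_succ fun i => by rw [hqs]; linarith
  have hqmem : ∀ i ≤ p, q i ∈ Icc a b := fun i hi =>
    ⟨hq0 ▸ hqmono (Nat.zero_le i), hqp ▸ hqmono hi⟩
  -- Each ramp is constant outside its subinterval, which keeps the interpolant bounded on all of
  -- `ℝ`. It costs two ReLUs, hence the index type `Fin p × Bool`.
  let r : ℕ → ℝ → ℝ := fun i t => max (t - q i) 0 - max (t - q (i + 1)) 0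
  let sl : ℕ → ℝ := fun i => (h (q (i + 1)) - h (q i)) / δ
  have hsl : ∀ i < p, |sl i| ≤ L := by
    intro i hi
    have h1 := hh _ (hqmem (i + 1) hi) _ (hqmem i hi.le)
    rw [hqs, add_sub_cancel_left, abs_of_pos hδ0] at h1
    simp only [sl]
    rw [abs_div, abs_of_pos hδ0, div_le_iff₀ hδ0, hqs]
    exact h1
  have hrmono : ∀ i, Monotone (r i) := by
    intro i s t hst
    have := hqs i
    simp only [r]
    rcases max_cases (s - q i) 0 with h1 | h1 <;> rcases max_cases (s - q (i + 1)) 0 with h2 | h2 <;>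
    rcases max_cases (t - q i) 0 with h3 | h3 <;> rcases max_cases (t - q (i + 1)) 0 with h4 | h4 <;>
    linarith [h1.1, h1.2, h2.1, h2.2, h3.1, h3.2, h4.1, h4.2]
  have hrsum : ∀ t, ∑ i ∈ Finset.range p, r i t = max (t - a) 0 - max (t - b) 0 := by
    intro t
    simp only [r]
    rw [Finset.sum_range_sub' (fun i => max (t - q i) 0), hq0, hqp]
  let ℓ : ℝ → ℝ := fun t => ∑ i ∈ Finset.range p, sl i * r i t + h a
  -- The ramps are monotone and their sum telescopes to a single ramp across `[a, b]`, so increments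
  -- of `ℓ` are dominated by `L` times those of that ramp. This gives both the Lipschitz and the
  -- global bound.
  have hlip : ∀ t s, s ≤ t → |ℓ t - ℓ s| ≤
      L * ((max (t - a) 0 - max (t - b) 0) - (max (s - a) 0 - max (s - b) 0)) := by
    intro t s hst
    have : ℓ t - ℓ s = ∑ i ∈ Finset.range p, sl i * (r i t - r i s) := by
      simp only [ℓ, mul_sub, Finset.sum_sub_distrib]; ring
    rw [this, ← hrsum, ← hrsum, ← Finset.sum_sub_distrib, Finset.mul_sum]
    refine (Finset.abs_sum_le_sum_abs _ _).trans (Finset.sum_le_sum fun i hi => ?_)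
    rw [abs_mul, abs_of_nonneg (sub_nonneg.2 (hrmono i hst))]
    exact mul_le_mul_of_nonneg_right (hsl i (Finset.mem_range.1 hi))
      (sub_nonneg.2 (hrmono i hst))
  have hclip : ∀ s t : ℝ, s ≤ t →
      (max (t - a) 0 - max (t - b) 0) - (max (s - a) 0 - max (s - b) 0) ≤ t - s ∧
      (max (t - a) 0 - max (t - b) 0) - (max (s - a) 0 - max (s - b) 0) ≤ b - a := by
    intro s t hst
    rcases max_cases (s - a) 0 with h1 | h1 <;> rcases max_cases (s - b) 0 with h2 | h2 <;>
    rcases max_cases (t - a) 0 with h3 | h3 <;> rcases max_cases (t - b) 0 with h4 | h4 <;>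
    constructor <;> linarith [h1.1, h1.2, h2.1, h2.2, h3.1, h3.2, h4.1, h4.2]
  have hlip1 : ∀ t s, |ℓ t - ℓ s| ≤ L * |t - s| := by
    intro t s
    rcases le_total s t with hst | hst
    · rw [abs_of_nonneg (sub_nonneg.2 hst)]
      exact (hlip t s hst).trans (mul_le_mul_of_nonneg_left (hclip s t hst).1 hL)
    · rw [abs_sub_comm, abs_sub_comm t, abs_of_nonneg (sub_nonneg.2 hst)]
      exact (hlip s t hst).trans (mul_le_mul_of_nonneg_left (hclip t s hst).1 hL)
  have hbdd : ∀ t, |ℓ t - ℓ a| ≤ L * (b - a) := by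
    intro t
    rcases le_total a t with hst | hst
    · exact (hlip t a hst).trans (mul_le_mul_of_nonneg_left (hclip a t hst).2 hL)
    · rw [abs_sub_comm]
      exact (hlip a t hst).trans (mul_le_mul_of_nonneg_left (hclip t a hst).2 hL)
  have hknot : ∀ k ≤ p, ℓ (q k) = h (q k) := by
    intro k hk
    have hr1 : ∀ i, i < k → r i (q k) = δ := by
      intro i hi
      have h1 : q (i + 1) ≤ q k := hqmono hi
      have := hqs i
      simp only [r]
      rw [max_eq_left (by linarith), max_eq_left (by linarith)]; linarith
    have hr2 : ∀ i, k ≤ i → r i (q k) = 0 := by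
      intro i hi
      have h1 : q k ≤ q i := hqmono hi
      have := hqs i
      simp only [r]
      rw [max_eq_right (by linarith), max_eq_right (by linarith)]; ring
    have h1 : ∑ i ∈ Finset.range p, sl i * r i (q k) = ∑ i ∈ Finset.range k, sl i * r i (q k) := by
      symm
      refine Finset.sum_subset (Finset.range_subset_range.2 hk) fun i _ hi => ?_
      rw [hr2 i (by simpa using hi), mul_zero]
    have h2 : ∑ i ∈ Finset.range k, sl i * r i (q k)
        = ∑ i ∈ Finset.range k, (h (q (i + 1)) - h (q i)) := by
      refine Finset.sum_congr rfl fun i hi => ?_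
      rw [hr1 i (Finset.mem_range.1 hi)]
      simp only [sl]
      field_simp
    simp only [ℓ]
    rw [h1, h2, Finset.sum_range_sub (fun i => h (q i)), hq0]; ring
  have hnear : ∀ s ∈ Icc a b, ∃ k ≤ p, |s - q k| ≤ δ := by
    intro s hs
    have h0 : 0 ≤ (s - a) / δ := div_nonneg (by linarith [hs.1]) hδ0.le
    refine ⟨⌊(s - a) / δ⌋₊, ?_, ?_⟩
    · have : (⌊(s - a) / δ⌋₊ : ℝ) ≤ p :=
        (Nat.floor_le h0).trans (by rw [div_le_iff₀ hδ0]; linarith [hs.2])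
      exact_mod_cast this
    · have h1 := Nat.floor_le h0
      have h2 := Nat.lt_floor_add_one ((s - a) / δ)
      rw [le_div_iff₀ hδ0] at h1
      rw [div_lt_iff₀ hδ0] at h2
      simp only [q]
      rw [abs_le]; constructor <;> linarith
  have hform : ∀ t, ∑ i : Fin p × Bool, (bif i.2 then sl i.1 else -sl i.1) *
      max (t - (bif i.2 then q i.1 else q (i.1 + 1))) 0 + h a = ℓ t := by
    intro t
    simp only [ℓ]
    rw [Fintype.sum_prod_type, ← Fin.sum_univ_eq_sum_range (fun i => sl i * r i t)]
    congr 1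
    refine Finset.sum_congr rfl fun i _ => ?_
    simp [r]; ring
  refine ⟨fun i => bif i.2 then sl i.1 else -sl i.1, fun i => bif i.2 then q i.1 else q (i.1 + 1),
    h a, |ℓ a| + L * (b - a), by positivity [mul_nonneg hL (sub_nonneg.2 hab.le)], ?_, ?_⟩
  · intro t
    rw [hform]
    have h1 := hbdd t
    have h2 := abs_add_le (ℓ t - ℓ a) (ℓ a)
    rw [sub_add_cancel] at h2
    linarith
  · intro t s hs
    rw [hform, ← hδ]
    -- Compare `ℓ t` with `ℓ s`, then `ℓ s` with the common value of `ℓ` and `h` at a nearby knot,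
    -- then that value with `h s`. Only `s` must lie in `[a, b]`.
    obtain ⟨k, hk, hks⟩ := hnear s hs
    have h1 := hlip1 t s
    have h2 := hlip1 s (q k)
    have h3 := hh s hs _ (hqmem k hk)
    have h4 := hknot k hk
    have h5 : L * |s - q k| ≤ L * δ := mul_le_mul_of_nonneg_left hks hL
    rw [abs_le] at h1 h2 h3 ⊢
    constructor <;> linarith [h1.1, h1.2, h2.1, h2.2, h3.1, h3.2]

/-! ### Soft indicators of boxes -/

/-- The closed box obtained by moving all faces of `∏ⱼ (a j, b j)` inwards by `δ`. -/
noncomputable def shrunkBox {d : ℕ} (a b : Fin d → ℝ) (δ : ℝ) : Set (Fin d → ℝ) :=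
  {x | ∀ j, a j + δ ≤ x j ∧ x j ≤ b j - δ}

/-- A continuous approximation of the indicator function of a box. -/
noncomputable def softIndicator {d : ℕ} (a b : Fin d → ℝ) (δ : ℝ) (x : Fin d → ℝ) : ℝ :=
  max (∑ j, -δ⁻¹ * max (a j + δ - x j) 0 + ∑ j, -δ⁻¹ * max (x j - (b j - δ)) 0 + 1) 0

section softIndicator

variable {d : ℕ} {a b : Fin d → ℝ} {δ : ℝ} {x : Fin d → ℝ}

theorem softIndicator_nonneg : 0 ≤ softIndicator a b δ x := le_max_right _ _

theorem softIndicator_le_one (hδ : 0 < δ) : softIndicator a b δ x ≤ 1 := by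
  refine max_le ?_ zero_le_one
  have h : ∀ f : Fin d → ℝ, ∑ j, -δ⁻¹ * max (f j) 0 ≤ 0 := fun f =>
    Finset.sum_nonpos fun j _ => mul_nonpos_of_nonpos_of_nonneg
      (neg_nonpos.2 (inv_nonneg.2 hδ.le)) (le_max_right _ _)
  linarith [h fun j => a j + δ - x j, h fun j => x j - (b j - δ)]

theorem softIndicator_eq_one (hx : x ∈ shrunkBox a b δ) : softIndicator a b δ x = 1 := by
  have h1 : ∀ j, max (a j + δ - x j) 0 = 0 := fun j => max_eq_right (by linarith [(hx j).1])
  have h2 : ∀ j, max (x j - (b j - δ)) 0 = 0 := fun j => max_eq_right (by linarith [(hx j).2])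
  simp [softIndicator, h1, h2]

/-- A point outside the open box lies on or beyond some face. The ramp of that face is then at least
`δ`, and after scaling it cancels the additive `1`. -/
theorem softIndicator_eq_zero (hδ : 0 < δ) (hx : x ∉ openBox a b) :
    softIndicator a b δ x = 0 := by
  have hi : 0 < δ⁻¹ := inv_pos.2 hδ
  have hn : ∀ f : Fin d → ℝ, ∀ j ∈ Finset.univ, 0 ≤ δ⁻¹ * max (f j) 0 := fun f j _ =>
    mul_nonneg hi.le (le_max_right _ _)
  have h0 : ∀ f : Fin d → ℝ, 0 ≤ ∑ j, δ⁻¹ * max (f j) 0 := fun f => Finset.sum_nonneg (hn f)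
  have h1 : ∀ f : Fin d → ℝ, ∀ j, δ ≤ f j → 1 ≤ ∑ j, δ⁻¹ * max (f j) 0 := by
    intro f j hj
    refine le_trans ?_ (Finset.single_le_sum (hn f) (Finset.mem_univ j))
    rw [← inv_mul_cancel₀ hδ.ne']
    exact mul_le_mul_of_nonneg_left (hj.trans (le_max_left _ _)) hi.le
  refine max_eq_right ?_
  simp only [neg_mul, Finset.sum_neg_distrib]
  simp only [openBox, mem_pi, mem_univ, forall_const, mem_Ioo, not_forall] at hx
  obtain ⟨j, hj⟩ := hx
  rcases lt_or_ge (a j) (x j) with h | h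
  · have h' : b j ≤ x j := not_lt.1 fun hb => hj ⟨h, hb⟩
    linarith [h0 fun j => a j + δ - x j, h1 (fun j => x j - (b j - δ)) j (by linarith)]
  · linarith [h0 fun j => x j - (b j - δ), h1 (fun j => a j + δ - x j) j (by linarith)]

end softIndicator

/-! ### Gluing local networks -/

theorem sum_ite_fst_eq {α β : Type*} [Fintype α] [DecidableEq α] [Fintype β] (k : α)
    (F : α × β → ℝ) : ∑ u : α × β, (if u.1 = k then F u else 0) = ∑ y, F (k, y) := by
  rw [Fintype.sum_prod_type, Finset.sum_eq_single k]
  · simp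
  · intro j _ hj
    simp [hj]
  · simp

/-- Shallow networks `g k` attached to boxes are glued to one network with three hidden layers,
after composition with a combination of ramps. Outside the thin shells of the boxes, the glued
network agrees with the composition for one of the boxes that contain the argument. -/
theorem exists_gluedNet {d G m p : ℕ} (g : Fin G → ReLUNet d [m]) (κ τ : Fin p × Bool → ℝ)
    (A₀ : ℝ) {A : ℝ} (hA : 0 ≤ A) (hℓ : ∀ t, |∑ i, κ i * max (t - τ i) 0 + A₀| ≤ A)
    (a b : Fin G → Fin d → ℝ) (δ : Fin G → ℝ) (hδ : ∀ k, 0 < δ k) :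
    ∃ I : ReLUNet d [G * (m + (d + d)), G * (p * 2 + 1), G],
      (∀ x, |I.realize x| ≤ 2 * A * G + A) ∧
      ∀ x, (∃ k, x ∈ openBox (a k) (b k)) →
        (∀ k, x ∈ openBox (a k) (b k) → x ∈ shrunkBox (a k) (b k) (δ k)) →
        ∃ k, x ∈ openBox (a k) (b k) ∧
          I.realize x = ∑ i, κ i * max ((g k).realize x - τ i) 0 + A₀ := by
  choose W β w β' hg using fun k => (g k).exists_realize_eq_sum
  -- Per box, the first layer holds the `m` neurons of `g k` and the `2d` face ramps. In the second,
  -- `none` computes the soft indicator and `some i` the ReLU of `g k - τ i`. The third holds one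
  -- gated output.
  have H := ReLUNet.exists_threeLayer (d := d)
    (ι₁ := Fin G × (Fin m ⊕ (Fin d ⊕ Fin d))) (ι₂ := Fin G × Option (Fin p × Bool)) (ι₃ := Fin G)
    (fun u => Sum.elim (W u.1) (Sum.elim (fun j => Pi.single j (-1)) (fun j => Pi.single j 1)) u.2)
    (fun u => Sum.elim (β u.1) (Sum.elim (fun j => a u.1 j + δ u.1)
      (fun j => -(b u.1 j - δ u.1))) u.2)
    (fun v u => if u.1 = v.1 then
      v.2.elim (Sum.elim (fun _ => 0) (fun _ => -(δ v.1)⁻¹) u.2)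
        (fun _ => Sum.elim (w v.1) (fun _ => 0) u.2) else 0)
    (fun v => v.2.elim 1 fun i => β' v.1 - τ i)
    (fun k v => v.2.elim (if v.1 = k then 2 * A else if v.1 < k then -(2 * A) else 0)
      (fun i => if v.1 = k then κ i else 0))
    (fun _ => A₀ + A - 2 * A) (fun _ => 1) (-A)
  have c₁ : Fintype.card (Fin G × (Fin m ⊕ (Fin d ⊕ Fin d))) = G * (m + (d + d)) := by simp
  have c₂ : Fintype.card (Fin G × Option (Fin p × Bool)) = G * (p * 2 + 1) := by simp
  rw [c₁, c₂, Fintype.card_fin] at H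
  obtain ⟨I, hI⟩ := H
  let ℓ : ℝ → ℝ := fun t => ∑ i, κ i * max (t - τ i) 0 + A₀
  let χ : Fin G → (Fin d → ℝ) → ℝ := fun k => softIndicator (a k) (b k) (δ k)
  -- The shift by `A` makes the signal lie in `[0, 2A]`. Hence a penalty of `2A` switches box `k`
  -- off when its indicator vanishes or an earlier one equals `1`.
  let v : Fin G → (Fin d → ℝ) → ℝ := fun k x => max (ℓ ((g k).realize x) + A
    - 2 * A * (1 - χ k x + ∑ j, if j < k then χ j x else 0)) 0
  have hfirst : ∀ x (y : Fin G × Option (Fin p × Bool)),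
      max (∑ u : Fin G × (Fin m ⊕ (Fin d ⊕ Fin d)), (if u.1 = y.1 then
        y.2.elim (Sum.elim (fun _ => 0) (fun _ => -(δ y.1)⁻¹) u.2)
        (fun _ => Sum.elim (w y.1) (fun _ => 0) u.2) else 0) *
        max (∑ j, Sum.elim (W u.1) (Sum.elim (fun j => Pi.single j (-1))
          (fun j => Pi.single j 1)) u.2 j * x j + Sum.elim (β u.1)
          (Sum.elim (fun j => a u.1 j + δ u.1) (fun j => -(b u.1 j - δ u.1))) u.2) 0 +
          y.2.elim 1 fun i => β' y.1 - τ i) 0 =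
      y.2.elim (χ y.1 x) fun i => max ((g y.1).realize x - τ i) 0 := by
    rintro x ⟨k, o⟩
    simp only [ite_mul, zero_mul]
    rw [sum_ite_fst_eq k]
    rcases o with _ | i
    · simp only [Option.elim, Fintype.sum_sum_type, Sum.elim_inl, Sum.elim_inr, zero_mul,
        Finset.sum_const_zero, zero_add, χ, softIndicator, Pi.single_apply, ite_mul,
        Finset.sum_ite_eq', Finset.mem_univ, if_true, neg_mul, one_mul]
      simp only [sub_eq_add_neg, add_comm, add_assoc]
    · simp only [Option.elim, Fintype.sum_sum_type, Sum.elim_inl, Sum.elim_inr, zero_mul,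
        Finset.sum_const_zero, add_zero, hg]
      rw [add_sub_assoc]
  have hIv : ∀ x, I.realize x = ∑ k, v k x - A := by
    intro x
    rw [hI, ← sub_eq_add_neg]
    congr 1
    refine Finset.sum_congr rfl fun k _ => ?_
    rw [one_mul]
    simp only [hfirst]
    simp only [v]
    congr 1
    rw [Fintype.sum_prod_type]
    simp only [Fintype.sum_option, Option.elim, Finset.sum_add_distrib]
    have h1 : ∑ j, (if j = k then 2 * A else if j < k then -(2 * A) else 0) * χ j x =
        2 * A * χ k x - 2 * A * ∑ j, if j < k then χ j x else 0 := by
      rw [Finset.mul_sum, eq_sub_iff_add_eq, ← Finset.sum_add_distrib]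
      rw [Finset.sum_eq_single k]
      · simp
      · intro j _ hj
        by_cases hjk : j < k <;> simp [hj, hjk]
      · simp
    have h2 : ∑ j, ∑ i, (if j = k then κ i else 0) * max ((g j).realize x - τ i) 0 =
        ∑ i, κ i * max ((g k).realize x - τ i) 0 := by
      rw [Finset.sum_eq_single k]
      · simp
      · intro j _ hj
        simp [hj]
      · simp
    rw [h1, h2]
    simp only [ℓ]
    ring
  have hχ0 : ∀ k x, 0 ≤ χ k x := fun k x => softIndicator_nonneg
  have hχ1 : ∀ k x, χ k x ≤ 1 := fun k x => softIndicator_le_one (hδ k)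
  have hterm : ∀ k x (j : Fin G), 0 ≤ if j < k then χ j x else 0 := fun k x j => by
    split_ifs
    exacts [hχ0 j x, le_rfl]
  have hsum : ∀ k x, 0 ≤ ∑ j, if j < k then χ j x else 0 := fun k x =>
    Finset.sum_nonneg fun j _ => hterm k x j
  have hv0 : ∀ k x, 0 ≤ v k x := fun k x => le_max_right _ _
  have hv1 : ∀ k x, v k x ≤ 2 * A := by
    intro k x
    refine max_le ?_ (by linarith)
    have h1 : 0 ≤ 2 * A * (1 - χ k x + ∑ j, if j < k then χ j x else 0) :=
      mul_nonneg (by linarith) (by linarith [hχ1 k x, hsum k x])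
    linarith [(abs_le.1 (hℓ ((g k).realize x))).2]
  have hvoff : ∀ k x, 1 ≤ 1 - χ k x + (∑ j, if j < k then χ j x else 0) → v k x = 0 := by
    intro k x h
    refine max_eq_right ?_
    have h1 := mul_le_mul_of_nonneg_left h (by linarith : (0 : ℝ) ≤ 2 * A)
    linarith [(abs_le.1 (hℓ ((g k).realize x))).2]
  refine ⟨I, fun x => ?_, fun x hx hgood => ?_⟩
  · rw [hIv, abs_le]
    have h0 : 0 ≤ ∑ k, v k x := Finset.sum_nonneg fun k _ => hv0 k x
    have h1 : ∑ k, v k x ≤ G * (2 * A) := by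
      have := Finset.sum_le_card_nsmul Finset.univ (fun k => v k x) (2 * A) fun k _ => hv1 k x
      simpa using this
    constructor <;> nlinarith
  · obtain ⟨k, hk, hmin⟩ : ∃ k, x ∈ openBox (a k) (b k) ∧
        ∀ j < k, x ∉ openBox (a j) (b j) := by
      classical
      have hne : (Finset.univ.filter fun k => x ∈ openBox (a k) (b k)).Nonempty := by
        obtain ⟨k, hk⟩ := hx
        exact ⟨k, by simp [hk]⟩
      refine ⟨_, (Finset.mem_filter.1 (Finset.min'_mem _ hne)).2, fun j hj hj' => ?_⟩
      exact absurd (Finset.min'_le _ j (by simp [hj'])) (not_le.2 hj)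
    have hχk : χ k x = 1 := softIndicator_eq_one (hgood k hk)
    refine ⟨k, hk, ?_⟩
    rw [hIv, Finset.sum_eq_single k]
    · have h1 : (∑ j, if j < k then χ j x else 0) = 0 := Finset.sum_eq_zero fun j _ => by
        split_ifs with hj
        exacts [softIndicator_eq_zero (hδ j) (hmin j hj), rfl]
      simp only [v]
      rw [hχk, h1, max_eq_left]
      · simp only [ℓ]; ring
      · linarith [(abs_le.1 (hℓ ((g k).realize x))).1]
    · intro j _ hj
      refine hvoff j x ?_
      -- Earlier boxes miss `x` by minimality of `k`; later ones are penalized by the indicator of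
      -- `k`.
      rcases lt_or_gt_of_ne hj with h | h
      · have h0 : χ j x = 0 := softIndicator_eq_zero (hδ j) (hmin j h)
        linarith [hsum j x]
      · have h1 := Finset.single_le_sum (fun i _ => hterm j x i) (Finset.mem_univ k)
        rw [if_pos h, hχk] at h1
        linarith [hχ1 j x]
    · simp

/-! ### Logistic loss and conditional risk -/

theorem logisticLoss_nonneg (t : ℝ) : 0 ≤ logisticLoss t :=
  Real.log_nonneg (by linarith [Real.exp_pos (-t)])

theorem measurable_logisticLoss : Measurable logisticLoss := by
  unfold logisticLoss
  fun_prop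

theorem logisticLoss_le (t : ℝ) : logisticLoss t ≤ 1 + |t| := by
  have h1 : 1 + Real.exp (-t) ≤ Real.exp 1 * Real.exp |t| := by
    have h2 : Real.exp (-t) ≤ Real.exp |t| := Real.exp_le_exp.2 (neg_le_abs t)
    have h3 : 1 ≤ Real.exp |t| := Real.one_le_exp (abs_nonneg t)
    have h4 : (2 : ℝ) ≤ Real.exp 1 := by linarith [Real.add_one_le_exp (1 : ℝ)]
    nlinarith
  rw [logisticLoss, Real.log_le_iff_le_exp (by positivity), Real.exp_add]
  exact h1

/-- The tangent line inequality for the convex function `logisticLoss`. -/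
theorem logisticLoss_tangent (s t : ℝ) :
    logisticLoss t - Real.sigmoid (-t) * (s - t) ≤ logisticLoss s := by
  have hp := Real.sigmoid_pos t
  have hn := Real.sigmoid_pos (-t)
  have hs := Real.sigmoid_neg t
  -- Jensen for `exp` at `0` and `t - s` with weights `σ(t)`, `σ(-t)`; its logarithm is the tangent
  -- inequality.
  have h1 := convexOn_exp.2 (mem_univ 0) (mem_univ (t - s)) hp.le hn.le (by linarith)
  simp only [smul_eq_mul, mul_zero, zero_add, Real.exp_zero, mul_one] at h1
  have h2 : Real.sigmoid t + Real.sigmoid (-t) * Real.exp (t - s)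
      = (1 + Real.exp (-s)) / (1 + Real.exp (-t)) := by
    rw [← Real.sigmoid_mul_rexp_neg, mul_assoc, ← Real.exp_add, Real.sigmoid_def,
      show -t + (t - s) = -s by ring]
    field_simp
  rw [h2] at h1
  have h3 := Real.log_le_log (Real.exp_pos _) h1
  rw [Real.log_exp, Real.log_div (by positivity) (by positivity)] at h3
  simp only [logisticLoss]
  linarith

theorem abs_sigmoid_sub_le (s t : ℝ) : |Real.sigmoid s - Real.sigmoid t| ≤ |s - t| := by
  have h := Convex.norm_image_sub_le_of_norm_deriv_le (f := Real.sigmoid) (C := 1) (s := univ)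
    (x := t) (y := s) (fun x _ => differentiable_sigmoid x) (fun x _ => by
      rw [Real.deriv_sigmoid, Real.norm_eq_abs, abs_le]
      have h0 := Real.sigmoid_pos x
      have h1 := Real.sigmoid_lt_one x
      constructor <;> nlinarith) convex_univ (mem_univ _) (mem_univ _)
  simpa using h

/-- The conditional logistic risk of the prediction `t` when the label is `1` with probability
`y`. -/
noncomputable def condRisk (y t : ℝ) : ℝ := y * logisticLoss t + (1 - y) * logisticLoss (-t)

theorem sigmoid_log_odds {y : ℝ} (h0 : 0 < y) (h1 : y < 1) :
    Real.sigmoid (Real.log (y / (1 - y))) = y := by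
  have : 0 < 1 - y := by linarith
  rw [Real.sigmoid_def, ← Real.log_inv, Real.exp_log (by positivity)]
  field_simp
  ring

/-- The tangent at the log-odds `s` has slope `σ(s) - y = 0`. -/
theorem condRisk_log_odds_le {y : ℝ} (h0 : 0 < y) (h1 : y < 1) (t : ℝ) :
    condRisk y (Real.log (y / (1 - y))) ≤ condRisk y t := by
  have hs := sigmoid_log_odds h0 h1
  set s := Real.log (y / (1 - y))
  have e1 := mul_le_mul_of_nonneg_left (logisticLoss_tangent t s) h0.le
  have e2 := mul_le_mul_of_nonneg_left (logisticLoss_tangent (-t) (-s)) (sub_nonneg.2 h1.le)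
  rw [Real.sigmoid_neg, hs] at e1
  rw [neg_neg, hs] at e2
  simp only [condRisk]
  nlinarith

/-- With tangents taken at `t`, the excess is at most `(σ(t) - σ(s))(t - s)`, where `s` is the
log-odds, and `σ` is `1`-Lipschitz. -/
theorem condRisk_le {y : ℝ} (h0 : 0 < y) (h1 : y < 1) (t : ℝ) :
    condRisk y t ≤ condRisk y (Real.log (y / (1 - y))) + (t - Real.log (y / (1 - y))) ^ 2 := by
  have hs := sigmoid_log_odds h0 h1
  set s := Real.log (y / (1 - y))
  have e1 := mul_le_mul_of_nonneg_left (logisticLoss_tangent s t) h0.le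
  have e2 := mul_le_mul_of_nonneg_left (logisticLoss_tangent (-s) (-t)) (sub_nonneg.2 h1.le)
  rw [Real.sigmoid_neg] at e1
  rw [neg_neg] at e2
  have e3 : (Real.sigmoid t - y) * (t - s) ≤ (t - s) ^ 2 := by
    rw [← hs, ← sq_abs (t - s), sq]
    refine (le_abs_self _).trans ?_
    rw [abs_mul]
    exact mul_le_mul_of_nonneg_right (abs_sigmoid_sub_le t s) (abs_nonneg _)
  simp only [condRisk]
  nlinarith

theorem condRisk_nonneg {y : ℝ} (hy : y ∈ Icc (0 : ℝ) 1) (t : ℝ) : 0 ≤ condRisk y t :=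
  add_nonneg (mul_nonneg hy.1 (logisticLoss_nonneg _))
    (mul_nonneg (sub_nonneg.2 hy.2) (logisticLoss_nonneg _))

theorem condRisk_le_one_add_abs {y : ℝ} (hy : y ∈ Icc (0 : ℝ) 1) (t : ℝ) :
    condRisk y t ≤ 1 + |t| := by
  have h1 := mul_le_mul_of_nonneg_left (logisticLoss_le t) hy.1
  have h2 := mul_le_mul_of_nonneg_left (logisticLoss_le (-t)) (sub_nonneg.2 hy.2)
  rw [abs_neg] at h2
  simp only [condRisk]
  linarith

theorem abs_log_sub_log_le {c s t : ℝ} (hc : 0 < c) (hs : c ≤ s) (ht : c ≤ t) :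
    |Real.log s - Real.log t| ≤ c⁻¹ * |s - t| := by
  have key : ∀ u v : ℝ, c ≤ u → c ≤ v → Real.log u - Real.log v ≤ c⁻¹ * |u - v| := by
    intro u v hu hv
    have hu0 : 0 < u := hc.trans_le hu
    have hv0 : 0 < v := hc.trans_le hv
    rw [← Real.log_div hu0.ne' hv0.ne']
    refine (Real.log_le_sub_one_of_pos (div_pos hu0 hv0)).trans ?_
    have : u / v - 1 = v⁻¹ * (u - v) := by field_simp
    rw [this]
    exact (mul_le_mul_of_nonneg_left (le_abs_self _) (inv_nonneg.2 hv0.le)).trans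
      (mul_le_mul_of_nonneg_right (inv_anti₀ hc hv) (abs_nonneg _))
  rw [abs_le]
  constructor
  · have := key t s ht hs
    rw [abs_sub_comm] at this
    linarith
  · exact key s t hs ht

theorem log_odds_lipschitz {c : ℝ} (hc : 0 < c) : ∀ s ∈ Icc c (1 - c), ∀ t ∈ Icc c (1 - c),
    |Real.log (s / (1 - s)) - Real.log (t / (1 - t))| ≤ 2 * c⁻¹ * |s - t| := by
  intro s hs t ht
  obtain ⟨hs1, hs2⟩ := hs
  obtain ⟨ht1, ht2⟩ := ht
  rw [Real.log_div (by linarith) (by linarith), Real.log_div (by linarith) (by linarith)]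
  have h1 := abs_log_sub_log_le hc hs1 ht1
  have h2 := abs_log_sub_log_le hc (by linarith : c ≤ 1 - s) (by linarith : c ≤ 1 - t)
  rw [show 1 - s - (1 - t) = -(s - t) by ring, abs_neg] at h2
  rw [abs_le] at h1 h2 ⊢
  constructor <;> linarith [h1.1, h1.2, h2.1, h2.2]

theorem IsRegressionFunction.measurable_logOdds {d : ℕ} {P : Measure ((Fin d → ℝ) × Fin 2)}
    {η : (Fin d → ℝ) → ℝ} (h : IsRegressionFunction P η) : Measurable (logOdds η) :=
  Real.measurable_log.comp (h.measurable.div (measurable_const.sub h.measurable))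

/-! ### The risk as an integral over the marginal -/

section risk

variable {d : ℕ} {P : Measure ((Fin d → ℝ) × Fin 2)} [IsProbabilityMeasure P]
  {η : (Fin d → ℝ) → ℝ}

instance : IsProbabilityMeasure (marginalX P) :=
  Measure.isProbabilityMeasure_map measurable_fst.aemeasurable

/-- The probability of the label `1` over a Borel set is an integral of the regression
function. -/
theorem IsRegressionFunction.measure_prod_one (h : IsRegressionFunction P η)
    {A : Set (Fin d → ℝ)} (hA : MeasurableSet A) :
    P (A ×ˢ {1}) = ∫⁻ x in A, ENNReal.ofReal (η x) ∂(marginalX P) := by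
  have hm : MeasurableSpace.comap (Prod.fst : (Fin d → ℝ) × Fin 2 → _) inferInstance
      ≤ (inferInstance : MeasurableSpace ((Fin d → ℝ) × Fin 2)) := measurable_fst.comap_le
  have hlab : (fun z : (Fin d → ℝ) × Fin 2 => label z.2)
      = (univ ×ˢ {1} : Set ((Fin d → ℝ) × Fin 2)).indicator 1 := by
    funext ⟨x, y⟩
    fin_cases y <;> simp [label, indicator]
  have hS : MeasurableSet (univ ×ˢ {1} : Set ((Fin d → ℝ) × Fin 2)) :=
    MeasurableSet.univ.prod (measurableSet_singleton _)
  have hint : Integrable (fun z : (Fin d → ℝ) × Fin 2 => label z.2) P := by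
    rw [hlab]
    exact (integrable_const (1 : ℝ)).indicator hS
  have hηi : Integrable η (marginalX P) :=
    Integrable.of_bound h.measurable.aestronglyMeasurable 1 (Filter.Eventually.of_forall fun x => by
      rw [Real.norm_eq_abs, abs_of_nonneg (h.mem_Icc x).1]; exact (h.mem_Icc x).2)
  have h1 := setIntegral_condExp hm hint (s := Prod.fst ⁻¹' A) ⟨A, hA, rfl⟩
  rw [← setIntegral_congr_ae (measurable_fst hA) (h.condExp_eq.mono fun z hz _ => hz)] at h1
  rw [hlab, setIntegral_indicator hS] at h1
  simp only [Pi.one_apply, setIntegral_const, smul_eq_mul, mul_one] at h1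
  have h2 : Prod.fst ⁻¹' A ∩ univ ×ˢ {1} = A ×ˢ ({1} : Set (Fin 2)) := by
    ext z; simp
  rw [h2] at h1
  have h3 : ∫ x in A, η x ∂(marginalX P) = ∫ z in Prod.fst ⁻¹' A, η z.1 ∂P :=
    setIntegral_map hA h.measurable.aestronglyMeasurable measurable_fst.aemeasurable
  rw [← ofReal_integral_eq_lintegral_ofReal hηi.integrableOn
    (Filter.Eventually.of_forall fun x => (h.mem_Icc x).1), h3, h1, ofReal_measureReal]

theorem IsRegressionFunction.map_restrict_one (h : IsRegressionFunction P η) :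
    (P.restrict (univ ×ˢ {1})).map Prod.fst
      = (marginalX P).withDensity fun x => ENNReal.ofReal (η x) := by
  ext A hA
  rw [Measure.map_apply measurable_fst hA, Measure.restrict_apply (measurable_fst hA),
    withDensity_apply _ hA, ← h.measure_prod_one hA]
  congr 1
  ext z; simp

theorem IsRegressionFunction.map_restrict_zero (h : IsRegressionFunction P η) :
    (P.restrict (univ ×ˢ {0})).map Prod.fst
      = (marginalX P).withDensity fun x => ENNReal.ofReal (1 - η x) := by
  ext A hA
  have hA1 : MeasurableSet (A ×ˢ ({1} : Set (Fin 2))) := hA.prod (measurableSet_singleton _)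
  rw [Measure.map_apply measurable_fst hA, Measure.restrict_apply (measurable_fst hA),
    withDensity_apply _ hA]
  have e1 : Prod.fst ⁻¹' A ∩ univ ×ˢ {0} = (Prod.fst ⁻¹' A) \ (A ×ˢ ({1} : Set (Fin 2))) := by
    ext ⟨x, y⟩
    fin_cases y <;> simp
  have e2 : A ×ˢ ({1} : Set (Fin 2)) ⊆ Prod.fst ⁻¹' A := fun z hz => hz.1
  rw [e1, measure_sdiff e2 hA1.nullMeasurableSet (measure_ne_top _ _), h.measure_prod_one hA]
  have e3 : ∀ x, ENNReal.ofReal (1 - η x) = 1 - ENNReal.ofReal (η x) := fun x => by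
    rw [ENNReal.ofReal_sub _ (h.mem_Icc x).1, ENNReal.ofReal_one]
  simp only [e3]
  rw [lintegral_sub h.measurable.ennreal_ofReal]
  · simp [marginalX, Measure.map_apply measurable_fst hA]
  · rw [← h.measure_prod_one hA]
    exact measure_ne_top _ _
  · exact Filter.Eventually.of_forall fun x => by
      simpa using (h.mem_Icc x).2

/-- The `φ`-risk is the mean of the conditional risk. -/
theorem IsRegressionFunction.phiRisk_eq (h : IsRegressionFunction P η) {g : (Fin d → ℝ) → ℝ}
    (hg : Measurable g) :
    phiRisk P g = ∫⁻ x, ENNReal.ofReal (condRisk (η x) (g x)) ∂(marginalX P) := by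
  have hS : MeasurableSet (univ ×ˢ {1} : Set ((Fin d → ℝ) × Fin 2)) :=
    MeasurableSet.univ.prod (measurableSet_singleton _)
  have hS0 : MeasurableSet (univ ×ˢ {0} : Set ((Fin d → ℝ) × Fin 2)) :=
    MeasurableSet.univ.prod (measurableSet_singleton _)
  have hc : (univ ×ˢ {1} : Set ((Fin d → ℝ) × Fin 2))ᶜ = univ ×ˢ {0} := by
    ext ⟨x, y⟩
    fin_cases y <;> simp
  have m1 : Measurable fun x => ENNReal.ofReal (logisticLoss (g x)) :=
    (measurable_logisticLoss.comp hg).ennreal_ofReal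
  have m0 : Measurable fun x => ENNReal.ofReal (logisticLoss (-g x)) :=
    (measurable_logisticLoss.comp hg.neg).ennreal_ofReal
  have me : Measurable fun x => ENNReal.ofReal (η x) := h.measurable.ennreal_ofReal
  have me0 : Measurable fun x => ENNReal.ofReal (1 - η x) :=
    (measurable_const.sub h.measurable).ennreal_ofReal
  rw [phiRisk, ← lintegral_add_compl _ hS, hc]
  have e1 : ∫⁻ z in univ ×ˢ {1}, ENNReal.ofReal (logisticLoss ((2 * label z.2 - 1) * g z.1)) ∂P
      = ∫⁻ x, ENNReal.ofReal (η x) * ENNReal.ofReal (logisticLoss (g x)) ∂(marginalX P) := by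
    refine Eq.trans ?_ (lintegral_withDensity_eq_lintegral_mul _ me m1)
    rw [← h.map_restrict_one,
      lintegral_map m1 measurable_fst]
    refine setLIntegral_congr_fun hS fun z hz => ?_
    have : z.2 = 1 := hz.2
    norm_num [this, label]
  have e0 : ∫⁻ z in univ ×ˢ {0}, ENNReal.ofReal (logisticLoss ((2 * label z.2 - 1) * g z.1)) ∂P
      = ∫⁻ x, ENNReal.ofReal (1 - η x) * ENNReal.ofReal (logisticLoss (-g x)) ∂(marginalX P) := by
    refine Eq.trans ?_ (lintegral_withDensity_eq_lintegral_mul _ me0 m0)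
    rw [← h.map_restrict_zero,
      lintegral_map m0 measurable_fst]
    refine setLIntegral_congr_fun hS0 fun z hz => ?_
    have : z.2 = 0 := hz.2
    norm_num [this, label]
  rw [e1, e0]
  refine (lintegral_add_left (me.mul m1) _).symm.trans ?_
  refine lintegral_congr fun x => ?_
  simp only [Pi.mul_apply]
  have hx := h.mem_Icc x
  rw [← ENNReal.ofReal_mul hx.1, ← ENNReal.ofReal_mul (sub_nonneg.2 hx.2),
    ← ENNReal.ofReal_add (mul_nonneg hx.1 (logisticLoss_nonneg _))
      (mul_nonneg (sub_nonneg.2 hx.2) (logisticLoss_nonneg _))]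
  rfl

/-- The integrand is minimized pointwise, and the log-odds is itself a measurable competitor. -/
theorem IsRegressionFunction.phiRisk_logOdds (h : IsRegressionFunction P η)
    (hη : ∀ᵐ x ∂(marginalX P), 0 < η x ∧ η x < 1) :
    phiRisk P (logOdds η) = optimalPhiRisk P := by
  refine le_antisymm (le_iInf fun g => ?_)
    (iInf_le (fun g : {g : (Fin d → ℝ) → ℝ // Measurable g} => phiRisk P g.1)
      ⟨logOdds η, h.measurable_logOdds⟩)
  rw [h.phiRisk_eq h.measurable_logOdds, h.phiRisk_eq g.2]
  exact lintegral_mono_ae (hη.mono fun x hx =>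
    ENNReal.ofReal_le_ofReal (condRisk_log_odds_le hx.1 hx.2 _))

/-- A function that is uniformly close to the log-odds up to a small exceptional set, and bounded
there, has small excess risk. -/
theorem IsRegressionFunction.phiRisk_le (h : IsRegressionFunction P η)
    (hη : ∀ᵐ x ∂(marginalX P), 0 < η x ∧ η x < 1) {g : (Fin d → ℝ) → ℝ} (hg : Measurable g)
    {ε R : ℝ} (E : Set (Fin d → ℝ)) (hE : MeasurableSet E)
    (hgR : ∀ x, |g x| ≤ R)
    (hgE : ∀ᵐ x ∂(marginalX P), x ∉ E → |g x - logOdds η x| ≤ ε) :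
    phiRisk P g ≤ phiRisk P (logOdds η) +
      (ENNReal.ofReal (ε ^ 2) + ENNReal.ofReal (1 + R) * marginalX P E) := by
  rw [h.phiRisk_eq hg, h.phiRisk_eq h.measurable_logOdds]
  have hpt : ∀ᵐ x ∂(marginalX P), ENNReal.ofReal (condRisk (η x) (g x)) ≤
      ENNReal.ofReal (condRisk (η x) (logOdds η x)) +
        (ENNReal.ofReal (ε ^ 2) + E.indicator (fun _ => ENNReal.ofReal (1 + R)) x) := by
    filter_upwards [hη, hgE] with x hx hxE
    by_cases hmem : x ∈ E
    · rw [indicator_of_mem hmem]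
      refine le_add_left (le_add_left (ENNReal.ofReal_le_ofReal ?_))
      linarith [condRisk_le_one_add_abs (h.mem_Icc x) (g x), hgR x]
    · refine le_trans ?_ (add_le_add_right (le_add_right le_rfl) _)
      rw [← ENNReal.ofReal_add (condRisk_nonneg (h.mem_Icc x) _) (sq_nonneg _)]
      refine ENNReal.ofReal_le_ofReal ((condRisk_le hx.1 hx.2 (g x)).trans ?_)
      have := hxE hmem
      refine add_le_add le_rfl ?_
      exact sq_le_sq' (abs_le.1 this).1 (abs_le.1 this).2
  refine (lintegral_mono_ae hpt).trans ?_
  have hmeas : Measurable fun x => ENNReal.ofReal (ε ^ 2) +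
      E.indicator (fun _ => ENNReal.ofReal (1 + R)) x :=
    Measurable.const_add (measurable_const.indicator hE) _
  rw [lintegral_add_right _ hmeas, lintegral_add_left measurable_const, lintegral_const, measure_univ, mul_one,
    lintegral_indicator_const hE]

end risk

/-! ### Thin shells of boxes -/

section boxes

variable {d : ℕ} (a b : Fin d → ℝ)

theorem measurableSet_openBox : MeasurableSet (openBox a b) :=
  MeasurableSet.univ_pi fun _ => measurableSet_Ioo

theorem measurableSet_shrunkBox (δ : ℝ) : MeasurableSet (shrunkBox a b δ) := by
  have : shrunkBox a b δ = Set.univ.pi fun j => Icc (a j + δ) (b j - δ) := by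
    ext x
    simp only [shrunkBox, mem_ofPred_eq, mem_pi, mem_univ, forall_const, mem_Icc]
  rw [this]
  exact MeasurableSet.univ_pi fun _ => measurableSet_Icc

/-- Thin shells of boxes have small measure. -/
theorem exists_measure_shell_le (μ : Measure (Fin d → ℝ)) [IsFiniteMeasure μ] {ε : ℝ≥0∞}
    (hε : 0 < ε) : ∃ δ : ℝ, 0 < δ ∧ μ (openBox a b \ shrunkBox a b δ) ≤ ε := by
  -- The box is open, so the shells decrease to the empty set; continuity from above needs no rate.
  let s : ℕ → Set (Fin d → ℝ) := fun n => openBox a b \ shrunkBox a b (1 / ((n : ℝ) + 1))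
  have hs : Antitone s := by
    intro n n' hnn
    refine sdiff_subset_sdiff_right fun x hx j => ?_
    have h1 : 1 / ((n' : ℝ) + 1) ≤ 1 / ((n : ℝ) + 1) := Nat.one_div_le_one_div hnn
    exact ⟨by linarith [(hx j).1], by linarith [(hx j).2]⟩
  have hlim := tendsto_measure_iInter_atTop (μ := μ) (s := s)
    (fun n => ((measurableSet_openBox a b).diff (measurableSet_shrunkBox a b _)).nullMeasurableSet)
    hs ⟨0, measure_ne_top _ _⟩
  have hempty : ⋂ n, s n = ∅ := by
    refine eq_empty_of_forall_notMem fun x hx => ?_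
    rw [mem_iInter] at hx
    have hbox : ∀ j, a j < x j ∧ x j < b j := by simpa [openBox] using (hx 0).1
    have hev : ∀ᶠ n : ℕ in Filter.atTop, ∀ j,
        1 / ((n : ℝ) + 1) < x j - a j ∧ 1 / ((n : ℝ) + 1) < b j - x j := by
      refine Filter.eventually_all.2 fun j => ?_
      exact (tendsto_one_div_add_atTop_nhds_zero_nat.eventually_lt_const
        (sub_pos.2 (hbox j).1)).and (tendsto_one_div_add_atTop_nhds_zero_nat.eventually_lt_const
        (sub_pos.2 (hbox j).2))
    obtain ⟨n, hn⟩ := hev.exists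
    exact (hx n).2 fun j => ⟨by linarith [(hn j).1], by linarith [(hn j).2]⟩
  rw [hempty, measure_empty] at hlim
  obtain ⟨n, hn⟩ := (hlim.eventually_lt_const hε).exists
  exact ⟨1 / ((n : ℝ) + 1), by positivity, hn.le⟩

end boxes

/-! ### Risk, size and conclusion -/

/-- A risk bound for networks glued from shallow networks that approximate the regression function
on the boxes of a cover. -/
theorem exists_net_phiRisk_le {d G m : ℕ} {P : Measure ((Fin d → ℝ) × Fin 2)}
    [IsProbabilityMeasure P] {η : (Fin d → ℝ) → ℝ} (h : IsRegressionFunction P η) {c : ℝ}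
    (hc : 0 < c) (hη : ∀ᵐ x ∂(marginalX P), c ≤ η x ∧ η x ≤ 1 - c) {a b : Fin G → Fin d → ℝ}
    (hcov : ∀ᵐ x ∂(marginalX P), ∃ k, x ∈ openBox (a k) (b k)) (hm : 1 ≤ m)
    (g : Fin G → ReLUNet d [m]) {ε : ℝ}
    (hg : ∀ k, ∀ x ∈ openBox (a k) (b k), |η x - (g k).realize x| ≤ ε) {ρ : ℝ} (hρ : 0 < ρ) :
    ∃ I : ReLUNet d [G * (m + (d + d)), G * (m * 2 + 1), G],
      phiRisk P I.realize ≤ phiRisk P (logOdds η) +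
        ENNReal.ofReal ((4 * c⁻¹ * (ε + 2 / m)) ^ 2 + ρ) := by
  have hm0 : (0 : ℝ) < m := by exact_mod_cast hm
  have hη01 : ∀ᵐ x ∂(marginalX P), 0 < η x ∧ η x < 1 :=
    hη.mono fun x hx => ⟨by linarith [hx.1], by linarith [hx.2]⟩
  have hc2 : c ≤ 1 - c := by
    obtain ⟨x, hx⟩ := hη.exists
    exact hx.1.trans hx.2
  -- With `c/2` in place of `c` the interval stays nondegenerate even if `c = 1/2`.
  obtain ⟨κ, τ, A₀, A, hA, hbd, happ⟩ := exists_ramp_interpolation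
    (a := c / 2) (b := 1 - c / 2) (by linarith) (by positivity : 0 ≤ 2 * (c / 2)⁻¹)
    (log_odds_lipschitz (half_pos hc)) hm
  have hR : 0 ≤ 2 * A * G + A := by positivity
  -- The `G` shells, weighted by the crude loss bound `1 + R` with `R = 2AG + A`, then cost at most
  -- `ρ`.
  have hρ' : 0 < ENNReal.ofReal (ρ / ((1 + (2 * A * G + A)) * (G + 1))) :=
    ENNReal.ofReal_pos.2 (by positivity)
  choose δ hδ hδm using fun k => exists_measure_shell_le (a k) (b k) (marginalX P) hρ'
  obtain ⟨I, hIR, hI⟩ := exists_gluedNet g κ τ A₀ hA hbd a b δ hδ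
  refine ⟨I, ?_⟩
  let E : Set (Fin d → ℝ) := ⋃ k, openBox (a k) (b k) \ shrunkBox (a k) (b k) (δ k)
  have hE : MeasurableSet E := MeasurableSet.iUnion fun k =>
    (measurableSet_openBox _ _).diff (measurableSet_shrunkBox _ _ _)
  have hEm : ENNReal.ofReal (1 + (2 * A * G + A)) * marginalX P E ≤ ENNReal.ofReal ρ := by
    have h1 : marginalX P E ≤
        G * ENNReal.ofReal (ρ / ((1 + (2 * A * G + A)) * (G + 1))) := by
      refine (measure_iUnion_le _).trans ?_
      rw [tsum_fintype]
      refine (Finset.sum_le_card_nsmul _ _ _ fun k _ => hδm k).trans ?_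
      simp
    refine (mul_le_mul_right h1 _).trans ?_
    rw [← ENNReal.ofReal_natCast, ← ENNReal.ofReal_mul (by positivity),
      ← ENNReal.ofReal_mul (by positivity)]
    refine ENNReal.ofReal_le_ofReal ?_
    rw [mul_div_assoc', mul_div_assoc', div_le_iff₀ (by positivity)]
    have : 0 ≤ (1 + (2 * A * G + A)) * ρ := by positivity
    nlinarith
  refine (h.phiRisk_le hη01 I.measurable_realize E hE hIR
    (ε := 4 * c⁻¹ * (ε + 2 / m)) ?_).trans ?_
  · filter_upwards [hη, hcov] with x hx hxc hxE
    have hgood : ∀ k, x ∈ openBox (a k) (b k) → x ∈ shrunkBox (a k) (b k) (δ k) := by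
      intro k hk
      by_contra hn
      exact hxE (mem_iUnion.2 ⟨k, hk, hn⟩)
    obtain ⟨k, hk, hIk⟩ := hI x hxc hgood
    rw [hIk, logOdds]
    refine (happ _ _ ⟨by linarith [hx.1], by linarith [hx.2]⟩).trans ?_
    have h1 := hg k x hk
    rw [abs_sub_comm] at h1
    have h2 : (1 - c / 2 - c / 2) / (m : ℝ) ≤ 1 / m :=
      div_le_div_of_nonneg_right (by linarith) hm0.le
    have h3 : 2 * (c / 2)⁻¹ = 4 * c⁻¹ := by rw [inv_div]; ring
    rw [h3]
    have h4 : 0 ≤ 4 * c⁻¹ := by positivity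
    calc 4 * c⁻¹ * |(g k).realize x - η x| + 2 * (4 * c⁻¹) * ((1 - c / 2 - c / 2) / m)
        ≤ 4 * c⁻¹ * ε + 2 * (4 * c⁻¹) * (1 / m) := by gcongr
      _ = 4 * c⁻¹ * (ε + 2 / m) := by ring
  · rw [ENNReal.ofReal_add (sq_nonneg _) hρ.le]
    gcongr

/-- Since `d ≤ m`, every product of consecutive widths is `O((Gm)²)`. -/
theorem paramCount_glued_le {G m d N : ℕ} (hG : 1 ≤ G) (hd : 1 ≤ d) (hdm : d ≤ m)
    (hm : m * m ≤ N) :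
    ReLUNet.paramCount d [G * (m + (d + d)), G * (m * 2 + 1), G] ≤ 100 * G ^ 2 * (N + d) := by
  have hm1 : 1 ≤ m := hd.trans hdm
  simp only [ReLUNet.paramCount]
  have e1 : G * (m + (d + d)) ≤ G * (3 * m) := Nat.mul_le_mul_left _ (by omega)
  have e2 : G * (m * 2 + 1) ≤ G * (3 * m) := Nat.mul_le_mul_left _ (by omega)
  have e3 : 1 ≤ G * m := Nat.mul_pos hG hm1
  have e4 : G * m ≤ (G * m) * (G * m) := Nat.le_mul_self _
  have e5 : G ≤ G * m := Nat.le_mul_of_pos_right _ hm1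
  have e6 : G * (3 * m) * (d + 1) ≤ G * (3 * m) * (2 * (G * m)) :=
    Nat.mul_le_mul_left _ (by nlinarith)
  have e7 : G * (G * (3 * m) + 1) ≤ (G * m) * (4 * (G * m)) := Nat.mul_le_mul e5 (by linarith)
  have e8 : (G * m) * (G * m) ≤ G ^ 2 * (N + d) := by
    calc (G * m) * (G * m) = G ^ 2 * (m * m) := by ring
      _ ≤ G ^ 2 * (N + d) := Nat.mul_le_mul_left _ (by omega)
  calc G * (m + (d + d)) * (d + 1) + (G * (m * 2 + 1) * (G * (m + (d + d)) + 1) +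
        (G * (G * (m * 2 + 1) + 1) + (G + 1)))
      ≤ G * (3 * m) * (d + 1) + (G * (3 * m) * (G * (3 * m) + 1) +
        (G * (G * (3 * m) + 1) + (G + 1))) := by gcongr
    _ ≤ 100 * ((G * m) * (G * m)) := by nlinarith
    _ ≤ 100 * G ^ 2 * (N + d) := by linarith

theorem rpow_neg_half {x : ℝ} (hx : 0 ≤ x) : x ^ (-(1 / 2) : ℝ) = (Real.sqrt x)⁻¹ := by
  rw [Real.rpow_neg hx, Real.sqrt_eq_rpow]

/-- The term `2/m` is absorbed by replacing `B` with `B + 2`, and `√N ≤ 2m` turns `16` into `32`.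
The final `+ 1` pays for the shells. -/
theorem sq_error_le {c B : ℝ} (hc : 0 < c) (hB : 0 < B) {d m N : ℕ} (hd : 1 ≤ d)
    (hm : 1 ≤ m) (hN : 1 ≤ N) (hmN : N < (m + 1) * (m + 1)) :
    (4 * c⁻¹ * (Real.sqrt d * B * (m : ℝ) ^ (-(1 / 2) : ℝ) + 2 / m)) ^ 2 +
      (N : ℝ) ^ (-(1 / 2) : ℝ) ≤
      (32 * c⁻¹ ^ 2 * (B + 2) ^ 2 + 1) * d * (N : ℝ) ^ (-(1 / 2) : ℝ) := by
  have hm0 : (1 : ℝ) ≤ m := by exact_mod_cast hm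
  have hd0 : (1 : ℝ) ≤ d := by exact_mod_cast hd
  have hN0 : (0 : ℝ) < N := by exact_mod_cast hN
  rw [rpow_neg_half (x := m) (by positivity), rpow_neg_half hN0.le]
  have hsm : 1 ≤ Real.sqrt m := Real.one_le_sqrt.2 hm0
  have hsd : 1 ≤ Real.sqrt d := Real.one_le_sqrt.2 hd0
  have hsN : 0 < Real.sqrt N := Real.sqrt_pos.2 hN0
  have hmm : Real.sqrt m * Real.sqrt m = m := Real.mul_self_sqrt (by positivity)
  have hdd : Real.sqrt d * Real.sqrt d = d := Real.mul_self_sqrt (by positivity)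
  have h1 : 2 / (m : ℝ) ≤ Real.sqrt d * 2 * (Real.sqrt m)⁻¹ := by
    rw [div_le_iff₀ (by positivity), mul_assoc, inv_mul_eq_div, Real.div_sqrt]
    nlinarith
  have h2 : Real.sqrt N ≤ 2 * m := by
    rw [Real.sqrt_le_left (by positivity)]
    have : (N : ℝ) ≤ (m + 1) * (m + 1) := by exact_mod_cast hmN.le
    nlinarith
  have h3 : (m : ℝ)⁻¹ ≤ 2 * (Real.sqrt N)⁻¹ := by
    rw [inv_le_iff_one_le_mul₀ (by positivity), ← div_eq_mul_inv, div_mul_eq_mul_div,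
      le_div_iff₀ hsN]
    linarith
  have h4 : (4 * c⁻¹ * (Real.sqrt d * B * (Real.sqrt m)⁻¹ + 2 / m)) ^ 2 ≤
      16 * c⁻¹ ^ 2 * (B + 2) ^ 2 * d * (m : ℝ)⁻¹ := by
    calc (4 * c⁻¹ * (Real.sqrt d * B * (Real.sqrt m)⁻¹ + 2 / m)) ^ 2
        ≤ (4 * c⁻¹ * (Real.sqrt d * B * (Real.sqrt m)⁻¹ +
          Real.sqrt d * 2 * (Real.sqrt m)⁻¹)) ^ 2 := by gcongr
      _ = 16 * c⁻¹ ^ 2 * (B + 2) ^ 2 * (Real.sqrt d * Real.sqrt d) *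
          (Real.sqrt m * Real.sqrt m)⁻¹ := by rw [mul_inv]; ring
      _ = _ := by rw [hmm, hdd]
  have h5 : 16 * c⁻¹ ^ 2 * (B + 2) ^ 2 * d * (m : ℝ)⁻¹ ≤
      16 * c⁻¹ ^ 2 * (B + 2) ^ 2 * d * (2 * (Real.sqrt N)⁻¹) := by gcongr
  have h6 : (Real.sqrt N)⁻¹ ≤ d * (Real.sqrt N)⁻¹ :=
    le_mul_of_one_le_left (by positivity) hd0
  linarith

theorem mainTheorem5 :
    ∃ K : ℕ → ℝ, ∀ c B : ℝ, 0 < c → 0 < B → ∃ C : ℝ, 0 < C ∧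
      ∀ (d : ℕ), 1 < d →
      ∀ (P : MeasureTheory.Measure ((Fin d → ℝ) × Fin 2)) [MeasureTheory.IsProbabilityMeasure P]
        (η : (Fin d → ℝ) → ℝ) (Ω : Set (Fin d → ℝ)) (M : ℕ) (U : Fin M → Set (Fin d → ℝ)),
        DistributionAssumption P η c B Ω U →
          phiRisk P (logOdds η) = optimalPhiRisk P ∧
          ∀ N : ℕ, 1 ≤ N →
            ∃ p₁ p₂ p₃ : ℕ, 1 ≤ p₁ ∧ 1 ≤ p₂ ∧ 1 ≤ p₃ ∧
              (ReLUNet.paramCount d [p₁, p₂, p₃] : ℝ) ≤ K (boxNumber Ω U) * (N + d) ∧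
              ∃ I : ReLUNet d [p₁, p₂, p₃],
                excessPhiRisk P I.realize = phiRisk P I.realize - phiRisk P (logOdds η) ∧
                excessPhiRisk P I.realize ≤
                  ENNReal.ofReal (C * d * (N : ℝ) ^ (-(1 / 2) : ℝ)) := by
  refine ⟨fun G => 100 * (G : ℝ) ^ 2, fun c B hc hB =>
    ⟨32 * c⁻¹ ^ 2 * (B + 2) ^ 2 + 1, by positivity, fun d hd P _ η Ω M U hP => ?_⟩⟩
  have hη01 : ∀ᵐ x ∂(marginalX P), 0 < η x ∧ η x < 1 :=
    hP.bounded_away.mono fun x hx => ⟨by linarith [hx.1], by linarith [hx.2]⟩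
  have hopt := hP.regression.phiRisk_logOdds hη01
  refine ⟨hopt, fun N hN => ?_⟩
  obtain ⟨a, b, hcov, hsub⟩ := hasBoxCover_boxNumber hP.compact hP.isOpen hP.cover
  generalize boxNumber Ω U = G at a b hcov hsub ⊢
  have hΩ : ∀ᵐ x ∂(marginalX P), ∃ k, x ∈ openBox (a k) (b k) := by
    filter_upwards [compl_mem_ae_iff.2 hP.supported] with x hx
    exact mem_iUnion.1 (hcov (not_not.1 hx))
  have hG : 1 ≤ G := by
    obtain ⟨x, k, -⟩ := hΩ.exists
    exact Nat.one_le_iff_ne_zero.2 fun h => (h ▸ k).elim0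
  have hN0 : (0 : ℝ) < N := by exact_mod_cast hN
  obtain ⟨m, hm⟩ : ∃ m, m = Nat.sqrt N := ⟨_, rfl⟩
  have hmN : N < (m + 1) * (m + 1) := hm ▸ Nat.lt_succ_sqrt N
  have hmN' : m * m ≤ N := hm ▸ Nat.sqrt_le N
  have hG1 : (1 : ℝ) ≤ G := by exact_mod_cast hG
  -- If `m < d`, then `N < (m + 1)² ≤ d²`, so `d N^{-1/2} ≥ 1`. This dominates the excess risk of
  -- the zero network, bounded by taking the whole space as exceptional set.
  rcases lt_or_ge m d with hmd | hdm
  · obtain ⟨I, hI⟩ := ReLUNet.exists_const_zero d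
    refine ⟨1, 1, 1, le_rfl, le_rfl, le_rfl, ?_, I, by rw [excessPhiRisk, hopt], ?_⟩
    · have h1 : ReLUNet.paramCount d [1, 1, 1] = d + 7 := by
        simp only [ReLUNet.paramCount]; ring
      rw [h1]
      have h2 : (1 : ℝ) ≤ N := by exact_mod_cast hN
      have h3 : (1 : ℝ) ≤ (G : ℝ) ^ 2 := one_le_pow₀ hG1
      push_cast
      nlinarith
    · rw [excessPhiRisk, ← hopt, tsub_le_iff_left]
      refine (hP.regression.phiRisk_le hη01 I.measurable_realize univ MeasurableSet.univ
        (ε := 0) (R := 0) (fun x => by simp [hI]) (by simp)).trans ?_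
      have h1 : (1 : ℝ) ≤ (32 * c⁻¹ ^ 2 * (B + 2) ^ 2 + 1) * d * (N : ℝ) ^ (-(1 / 2) : ℝ) := by
        have h2 : Real.sqrt N ≤ d := by
          rw [Real.sqrt_le_left (by positivity), sq]
          exact_mod_cast hmN.le.trans (Nat.mul_le_mul hmd hmd)
        rw [rpow_neg_half hN0.le, ← div_eq_mul_inv, le_div_iff₀ (Real.sqrt_pos.2 hN0), one_mul]
        refine h2.trans (le_mul_of_one_le_left (by positivity) ?_)
        linarith [show 0 ≤ 32 * c⁻¹ ^ 2 * (B + 2) ^ 2 by positivity]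
      gcongr
      simpa using h1
  · have hm1 : 1 ≤ m := by omega
    have hnet : ∀ k, ∃ g : ReLUNet d [m], ∀ x ∈ openBox (a k) (b k),
        |η x - g.realize x| ≤ Real.sqrt d * B * (m : ℝ) ^ (-(1 / 2) : ℝ) := by
      intro k
      obtain ⟨i, hi⟩ := hsub k
      obtain ⟨g, hg, -⟩ := (hP.barron i).approx m hm1
      exact ⟨g, fun x hx => hg x (hi hx)⟩
    choose g hg using hnet
    obtain ⟨I, hI⟩ := exists_net_phiRisk_le hP.regression hc hP.bounded_away hΩ hm1 g hg
      (ρ := (N : ℝ) ^ (-(1 / 2) : ℝ)) (by positivity)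
    refine ⟨_, _, _, Nat.mul_pos hG (by omega), Nat.mul_pos hG (by omega), hG, ?_, I,
      by rw [excessPhiRisk, hopt], ?_⟩
    · beta_reduce
      exact_mod_cast paramCount_glued_le hG hd.le hdm hmN'
    · rw [excessPhiRisk, ← hopt, tsub_le_iff_left]
      exact hI.trans (add_le_add_right (ENNReal.ofReal_le_ofReal
        (sq_error_le hc hB hd.le hm1 hN hmN)) _)
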